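/- Consider the stochastic multi-armed bandit problem with $K\ge 1$ arms whose rewards are Bernoulli with means $\mu_1,\dots,\mu_K\in[0,1)$: in each round $t=1,2,\dots$ a policy chooses an arm $A_t\in\{1,\dots,K\}$ (possibly at random) given the arms drawn and rewards observed before, and then receives a reward $R_t\in\{0,1\}$ drawn from the Bernoulli distribution $\mathcal B(\mu_{A_t})$. Write $\mu^*=\max_a\mu_a$, $\Delta_a=\mu^*-\mu_a$, $$K(p,q)=p\ln\frac pq+(1-p)\ln\frac{1-p}{1-q}$$ (with $0\ln 0=0$), let $N_{a,T}$ be the number of draws of arm $a$ and $S_{a,T}$ the number of successes (rewards equal to $1$) observed from arm $a$ in the first $T$ rounds, and let $\mathcal R(T)=T\mu^*-\mathbb E\left[\sum_{t=1}^T R_t\right]$ be the expected cumulative regret. Thompson Sampling (with uniform priors) draws in round $t+1$, given the past, independent samples $\theta_a\sim\mathrm{Beta}(S_{a,t}+1,\,N_{a,t}-S_{a,t}+1)$, $a=1,\dots,K$, and chooses the arm with the highest sample. Then, for Thompson Sampling: 1. For every $\epsilon>0$ there is a constant $C=C(\epsilon,\mu_1,\dots,\mu_K)$ such that for all integers $T\ge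 2$ $$\mathcal R(T)\le(1+\epsilon)\sum_{a:\,\mu_a\ne\mu^*}\frac{\Delta_a\,(\ln T+\ln\ln T)}{K(\mu_a,\mu^*)}+C.$$ 2. Thompson Sampling is asymptotically optimal in the sense of Lai and Robbins, i.e. it attains their lower bound with equality: for every arm $a$ with $\mu_a\neq\mu^*$, $$\lim_{T\to\infty}\frac{\mathbb E[N_{a,T}]}{\ln T}=\frac1{K(\mu_a,\mu^*)}.$$ -/

import Mathlib

open MeasureTheory ProbabilityTheory Filter Topology

noncomputable section

namespace BernoulliBandit

/-- What is observed in the first `t` rounds of a bandit with `K` arms: the arm drawn in each round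
and the reward obtained (`true` is the reward `1`, `false` the reward `0`). -/
abbrev History (K t : ℕ) : Type := Fin t → Fin K × Bool

/-- A (possibly randomised) policy: the distribution of the arm drawn in round `t + 1`, given the
history of the first `t` rounds. -/
abbrev Policy (K : ℕ) : Type := (t : ℕ) → History K t → PMF (Fin K)

instance bernoulliMeasure_isProbability (p : unitInterval) : IsProbabilityMeasure (bernoulliMeasure true false p) := by
  refine ⟨?_⟩
  classical
  exact bernoulliMeasure_apply_of_mem_of_mem p MeasurableSet.univ (Set.mem_univ _) (Set.mem_univ _)

/-- The reward distribution `B(p)`. -/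
def rewardLaw (p : unitInterval) : PMF Bool := (bernoulliMeasure true false p).toPMF

/-- The law of the history of the first `t` rounds when the policy `π` is run on the Bernoulli
bandit with means `μ`: in each round an arm `a` is drawn from `π` given the past, then a
reward is drawn from `B(μ a)`. -/
def historyLaw {K : ℕ} (π : Policy K) (μ : Fin K → unitInterval) : (t : ℕ) → PMF (History K t)
  | 0 => PMF.pure Fin.elim0
  | t + 1 =>
    (historyLaw π μ t).bind fun h =>
      (π t h).bind fun a =>
        (rewardLaw (μ a)).map fun r => Fin.snoc (α := fun _ => Fin K × Bool) h (a, r)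

/-- The expectation of `f` under a distribution on a finite type. -/
def expect {α : Type} [Fintype α] (p : PMF α) (f : α → ℝ) : ℝ := ∑ x, (p x).toReal * f x

/-- The number of draws `N a` of arm `a`. -/
def draws {K t : ℕ} (h : History K t) (a : Fin K) : ℕ :=
  (Finset.univ.filter fun i => (h i).1 = a).card

/-- The number of successes `S a` observed from arm `a`. -/
def successes {K t : ℕ} (h : History K t) (a : Fin K) : ℕ :=
  (Finset.univ.filter fun i => (h i).1 = a ∧ (h i).2 = true).card

/-- The cumulative reward `R 1 + ⋯ + R t`. -/
def totalReward {K t : ℕ} (h : History K t) : ℝ := ∑ i, if (h i).2 = true then 1 else 0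

/-- The mean of the best arm. -/
def bestMean {K : ℕ} (μ : Fin K → unitInterval) : ℝ := ⨆ a, (μ a : ℝ)

/-- The expected number of draws of arm `a` in the first `T` rounds. -/
def expectedDraws {K : ℕ} (π : Policy K) (μ : Fin K → unitInterval) (a : Fin K) (T : ℕ) : ℝ :=
  expect (historyLaw π μ T) fun h => (draws h a : ℝ)

/-- The expected cumulative regret `T μ* - E[R 1 + ⋯ + R T]`. -/
def regret {K : ℕ} (π : Policy K) (μ : Fin K → unitInterval) (T : ℕ) : ℝ :=
  T * bestMean μ - expect (historyLaw π μ T) totalReward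

/-- The Kullback-Leibler divergence between `B(p)` and `B(q)`, for `0 ≤ p ≤ 1` and `0 < q < 1`
(`0 * log 0 = 0`). -/
def klBernoulli (p q : ℝ) : ℝ :=
  p * Real.log (p / q) + (1 - p) * Real.log ((1 - p) / (1 - q))

/-- The posterior on the mean of arm `a`, for a uniform prior:
`Beta(S a + 1, N a - S a + 1)`. -/
def posterior {K t : ℕ} (h : History K t) (a : Fin K) : Measure ℝ :=
  betaMeasure (successes h a + 1 : ℝ) ((draws h a : ℝ) - successes h a + 1)

instance posterior_isProbability {K t : ℕ} (h : History K t) (a : Fin K) : IsProbabilityMeasure (posterior h a) := by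
  have hle : successes h a ≤ draws h a :=
    Finset.card_le_card (Finset.monotone_filter_right _ fun i _ hi => hi.1)
  have hle' : (successes h a : ℝ) ≤ draws h a := by exact_mod_cast hle
  exact isProbabilityMeasureBeta (by positivity) (by linarith)

/-- The arms with the highest sample. -/
def maximizers {K : ℕ} (θ : Fin K → ℝ) : Finset (Fin K) :=
  Finset.univ.filter fun a => ∀ b, θ b ≤ θ a

theorem maximizers_nonempty {K : ℕ} [NeZero K] (θ : Fin K → ℝ) : (maximizers θ).Nonempty := by
  obtain ⟨a, ha⟩ := Finite.exists_max θ
  exact ⟨a, by simpa [maximizers] using ha⟩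

/-- The arm with the highest sample (the first one in case of a tie, which has probability `0`
for samples from the posteriors). -/
def argmax {K : ℕ} [NeZero K] (θ : Fin K → ℝ) : Fin K :=
  (maximizers θ).min' (maximizers_nonempty θ)

theorem measurable_argmax {K : ℕ} [NeZero K] : Measurable (argmax (K := K)) := by
  have hm : ∀ a : Fin K, MeasurableSet {θ : Fin K → ℝ | a ∈ maximizers θ} := by
    intro a
    have : {θ : Fin K → ℝ | a ∈ maximizers θ} = ⋂ b, {θ : Fin K → ℝ | θ b ≤ θ a} := by
      ext θ
      simp [maximizers]
    rw [this]
    exact MeasurableSet.iInter fun b =>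
      measurableSet_le (measurable_pi_apply b) (measurable_pi_apply a)
  refine measurable_to_countable' fun a => ?_
  have : argmax ⁻¹' {a} = {θ : Fin K → ℝ | a ∈ maximizers θ} ∩
      ⋂ b, ⋂ (_ : b < a), {θ : Fin K → ℝ | b ∈ maximizers θ}ᶜ := by
    ext θ
    simp only [Set.mem_preimage, Set.mem_singleton_iff, Set.mem_inter_iff, Set.mem_iInter,
      Set.mem_compl_iff]
    constructor
    · rintro rfl
      exact ⟨show argmax θ ∈ maximizers θ from Finset.min'_mem _ _, fun b hb hbm => absurd (Finset.min'_le _ b hbm) (not_le.2 hb)⟩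
    · rintro ⟨h1, h2⟩
      refine le_antisymm (Finset.min'_le _ a h1) ?_
      by_contra hlt
      exact h2 _ (not_le.1 hlt) (show argmax θ ∈ maximizers θ from Finset.min'_mem _ _)
  rw [this]
  exact (hm a).inter (MeasurableSet.iInter fun b => MeasurableSet.iInter fun _ => (hm b).compl)

instance map_argmax_isProbability {K t : ℕ} [NeZero K] (h : History K t) :
    IsProbabilityMeasure ((Measure.pi (posterior h)).map argmax) :=
  Measure.isProbabilityMeasure_map measurable_argmax.aemeasurable

/-- Thompson Sampling: draw independent samples `θ a` from the posteriors of the arms and choose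
the arm with the highest sample. -/
def thompsonSampling (K : ℕ) [NeZero K] : Policy K :=
  fun _ h => ((Measure.pi (posterior h)).map argmax).toPMF

end BernoulliBandit

end

/-!
Both parts of the theorem rest on one upper bound (`exists_expectedDraws_le`): for a suboptimal arm
`a` and every `κ` below its divergence from the best arm, `E[N a] ≤ ln T / κ + C`. The regret is the
sum of the expected numbers of draws weighted by the gaps, so this gives the first part, and the
upper half of the limit in the second; the term `ln ln T` is not needed, except that it is bounded
below.

*Upper bound.* Choose levels `μ a < x < y < μ o`, where `o` is an optimal arm. A draw of `a` falls
into one of four classes.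
* The arm `a` has been drawn fewer than `ln T / κ` times. There are at most `ln T / κ + 1` such draws.
* The success rate of `a` exceeds `x`. As all draws of `a` are independent, the expected number of
  such draws is at most a convergent series of Chernoff bounds. The passage from the adaptive policy
  to binomial sampling is `expect_sum_draw_le_binomialExpect`, proved with a potential function.
* Otherwise, the sample of `a` exceeds `y`. The posterior after `n` draws has density
  `(n + 1) * choose n s * u ^ s * (1 - u) ^ (n - s)`, so a Chernoff bound shows that this has
  probability `O(1 / T)` in each round.
* The sample of `a`, hence every sample, is at most `y`. By independence of the samples this is at
  most the odds that the sample of `o` does not exceed `y`, times the probability to draw `o`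
  (`thompsonSampling_le`). Summed over the rounds, the expected odds are at most a convergent series
  over the number of draws of `o` (`summable_binomialExpect_odds`).

*Lower bound.* Raise the mean of `a` to some `q > μ*`. By the upper bound, `a` is then drawn in all
but `O(ln T)` rounds. The divergence between the laws of the two histories is `E[N a] * K(μ a, q)`,
and the Donsker-Varadhan inequality (`expect_sub_le_log_expect_exp`), applied to
`ln T * (1 - N a / T)`, shows that it is at least `(1 - o(1)) * ln T`. Then let `q` tend to `μ*`.
-/

namespace BernoulliBandit

open Finset

/-! ### Expectations under the law of the history -/

theorem expect_add {α : Type} [Fintype α] (p : PMF α) (f g : α → ℝ) :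
    expect p (fun x => f x + g x) = expect p f + expect p g := by
  simp [expect, mul_add, sum_add_distrib]

theorem expect_const_mul {α : Type} [Fintype α] (p : PMF α) (c : ℝ) (f : α → ℝ) :
    expect p (fun x => c * f x) = c * expect p f := by
  simp only [expect, mul_sum]
  exact sum_congr rfl fun x _ => by ring

theorem expect_sub {α : Type} [Fintype α] (p : PMF α) (f g : α → ℝ) :
    expect p (fun x => f x - g x) = expect p f - expect p g := by
  simp [expect, mul_sub, sum_sub_distrib]

theorem expect_sum {α ι : Type} [Fintype α] (p : PMF α) (s : Finset ι) (f : ι → α → ℝ) :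
    expect p (fun x => ∑ i ∈ s, f i x) = ∑ i ∈ s, expect p (f i) := by
  simp only [expect, mul_sum]
  exact sum_comm

theorem expect_mono {α : Type} [Fintype α] (p : PMF α) {f g : α → ℝ} (h : ∀ x, f x ≤ g x) :
    expect p f ≤ expect p g :=
  sum_le_sum fun x _ => mul_le_mul_of_nonneg_left (h x) ENNReal.toReal_nonneg

theorem expect_nonneg {α : Type} [Fintype α] (p : PMF α) {f : α → ℝ} (h : ∀ x, 0 ≤ f x) :
    0 ≤ expect p f :=
  sum_nonneg fun x _ => mul_nonneg ENNReal.toReal_nonneg (h x)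

theorem sum_toReal_eq_one {α : Type} [Fintype α] (p : PMF α) : ∑ x, (p x).toReal = 1 := by
  rw [← ENNReal.toReal_sum fun x _ => p.apply_ne_top x, ← tsum_fintype (L := .unconditional _),
    p.tsum_coe, ENNReal.toReal_one]

theorem expect_const {α : Type} [Fintype α] (p : PMF α) (c : ℝ) : expect p (fun _ => c) = c := by
  simp [expect, ← sum_mul, sum_toReal_eq_one]

theorem expect_bind {α β : Type} [Fintype α] [Fintype β] (p : PMF α) (q : α → PMF β) (f : β → ℝ) :
    expect (p.bind q) f = expect p fun x => expect (q x) f := by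
  have h (y : β) : (p.bind q y).toReal = ∑ x, (p x).toReal * (q x y).toReal := by
    rw [PMF.bind_apply, tsum_fintype, ENNReal.toReal_sum]
    · simp
    · exact fun x _ => ENNReal.mul_ne_top (p.apply_ne_top x) ((q x).apply_ne_top y)
  simp only [expect, h, sum_mul, mul_sum]
  rw [sum_comm]
  exact sum_congr rfl fun x _ => sum_congr rfl fun y _ => by ring

theorem expect_pure {α : Type} [Fintype α] (a : α) (f : α → ℝ) : expect (PMF.pure a) f = f a := by
  classical
  simp [expect, PMF.pure_apply, apply_ite ENNReal.toReal, ite_mul]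

theorem expect_map {α β : Type} [Fintype α] [Fintype β] (p : PMF α) (g : α → β) (f : β → ℝ) :
    expect (p.map g) f = expect p fun x => f (g x) := by
  simp only [PMF.map, expect_bind, Function.comp_apply, expect_pure]

theorem expect_rewardLaw (p : unitInterval) (f : Bool → ℝ) :
    expect (rewardLaw p) f = p * f true + (1 - p) * f false := by
  have h1 : (rewardLaw p true).toReal = p := by
    change (bernoulliMeasure true false p).real {true} = p
    rw [bernoulliMeasure_real_apply_of_mem_of_notMem p (measurableSet_singleton _) rfl (by simp)]
  have h2 : (rewardLaw p false).toReal = 1 - p := by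
    change (bernoulliMeasure true false p).real {false} = 1 - p
    rw [bernoulliMeasure_real_apply_of_notMem_of_mem p (measurableSet_singleton _) (by simp) rfl]
  simp [expect, h1, h2]

/-- The history obtained from `h` by one more round. -/
abbrev extend {K t : ℕ} (h : History K t) (a : Fin K) (r : Bool) : History K (t + 1) :=
  Fin.snoc (α := fun _ => Fin K × Bool) h (a, r)

theorem expect_historyLaw_succ {K : ℕ} (π : Policy K) (μ : Fin K → unitInterval) (t : ℕ)
    (f : History K (t + 1) → ℝ) :
    expect (historyLaw π μ (t + 1)) f = expect (historyLaw π μ t) fun h =>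
      ∑ a, (π t h a).toReal *
        (μ a * f (extend h a true) + (1 - μ a) * f (extend h a false)) := by
  simp only [historyLaw, expect_bind, expect_map, expect_rewardLaw]
  rfl

theorem draws_extend {K t : ℕ} (h : History K t) (a b : Fin K) (r : Bool) :
    draws (extend h a r) b = draws h b + if a = b then 1 else 0 := by
  simp only [draws, card_filter, Fin.sum_univ_castSucc, Fin.snoc_castSucc, Fin.snoc_last]

theorem successes_extend {K t : ℕ} (h : History K t) (a b : Fin K) (r : Bool) :
    successes (extend h a r) b = successes h b + if a = b ∧ r = true then 1 else 0 := by
  simp only [successes, card_filter, Fin.sum_univ_castSucc, Fin.snoc_castSucc, Fin.snoc_last]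

theorem totalReward_extend {K t : ℕ} (h : History K t) (a : Fin K) (r : Bool) :
    totalReward (extend h a r) = totalReward h + if r = true then 1 else 0 := by
  simp only [totalReward, Fin.sum_univ_castSucc, Fin.snoc_castSucc, Fin.snoc_last]

theorem successes_le_draws {K t : ℕ} (h : History K t) (a : Fin K) : successes h a ≤ draws h a :=
  card_le_card (monotone_filter_right _ fun _ _ hi => hi.1)

theorem sum_draws {K t : ℕ} (h : History K t) : ∑ a, draws h a = t := by
  simpa [draws] using (card_eq_sum_card_fiberwise (f := fun i => (h i).1) (s := univ) (t := univ)
    (fun _ _ => mem_coe.2 (mem_univ _))).symm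

section Dynamics

variable {K : ℕ} (π : Policy K) (μ : Fin K → unitInterval)

theorem expectedDraws_zero (a : Fin K) : expectedDraws π μ a 0 = 0 := by
  simp [expectedDraws, expect, draws]

theorem expectedDraws_succ (a : Fin K) (t : ℕ) :
    expectedDraws π μ a (t + 1) = expectedDraws π μ a t +
      expect (historyLaw π μ t) fun h => (π t h a).toReal := by
  simp only [expectedDraws]
  rw [expect_historyLaw_succ, ← expect_add]
  congr 1
  funext h
  have (b : Fin K) : (π t h b).toReal * (μ b * (draws (extend h b true) a : ℝ) +
      (1 - μ b) * (draws (extend h b false) a : ℝ)) =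
      (π t h b).toReal * draws h a + if b = a then (π t h b).toReal else 0 := by
    simp only [draws_extend]
    split_ifs <;> push_cast <;> ring
  simp [this, sum_add_distrib, ← sum_mul, sum_toReal_eq_one]

theorem expectedDraws_eq_sum (a : Fin K) (T : ℕ) :
    expectedDraws π μ a T =
      ∑ t ∈ range T, expect (historyLaw π μ t) fun h => (π t h a).toReal := by
  induction T with
  | zero => simp [expectedDraws_zero]
  | succ T ih => rw [expectedDraws_succ, sum_range_succ, ih]

theorem sum_expectedDraws (T : ℕ) : ∑ a, expectedDraws π μ a T = T := by
  simp only [expectedDraws]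
  rw [← expect_sum]
  have (h : History K T) : ∑ a, (draws h a : ℝ) = T := by exact_mod_cast sum_draws h
  simp only [this, expect_const]

theorem expect_totalReward (T : ℕ) :
    expect (historyLaw π μ T) totalReward = ∑ a, μ a * expectedDraws π μ a T := by
  induction T with
  | zero => simp [expectedDraws_zero, expect, totalReward]
  | succ t ih =>
    rw [expect_historyLaw_succ]
    simp only [expectedDraws_succ, mul_add, sum_add_distrib, ← ih]
    simp only [← expect_const_mul]
    rw [← expect_sum, ← expect_add]
    congr 1
    funext h
    have (b : Fin K) : (π t h b).toReal * (μ b * totalReward (extend h b true)) +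
      (π t h b).toReal * ((1 - μ b) * totalReward (extend h b false)) =
        (π t h b).toReal * totalReward h + μ b * (π t h b).toReal := by
      simp only [totalReward_extend]
      simp
      ring
    rw [← sum_add_distrib]
    simp [this, sum_add_distrib, ← sum_mul, sum_toReal_eq_one]

/-- The regret is the expected number of draws of each arm, weighted by its gap. -/
theorem regret_eq_sum (T : ℕ) :
    regret π μ T = ∑ a, (bestMean μ - μ a) * expectedDraws π μ a T := by
  simp only [regret, expect_totalReward, sub_mul, sum_sub_distrib, ← mul_sum, sum_expectedDraws]
  ring

end Dynamics

/-! ### From adaptive sampling to binomial sampling -/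

/-- The expectation of `f i`, where `i` is the number of successes in `k` independent trials with
success probability `m`. The sum is over the pairs (number of successes, number of failures). -/
def binomialExpect (m : ℝ) (k : ℕ) (f : ℕ → ℝ) : ℝ :=
  ∑ ij ∈ antidiagonal k, (k.choose ij.1 : ℝ) * (m ^ ij.1 * (1 - m) ^ ij.2 * f ij.1)

theorem binomialExpect_succ (m : ℝ) (k : ℕ) (f : ℕ → ℝ) :
    binomialExpect m (k + 1) f =
      m * binomialExpect m k (fun i => f (i + 1)) + (1 - m) * binomialExpect m k f := by
  rw [binomialExpect, sum_antidiagonal_choose_succ_mul (fun i j => m ^ i * (1 - m) ^ j * f i),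
    add_comm, binomialExpect, binomialExpect, mul_sum, mul_sum]
  congr 1
  · refine sum_congr rfl fun ij hij => ?_
    rw [← Nat.choose_symm_of_eq_add (mem_antidiagonal.1 hij).symm]
    ring
  · refine sum_congr rfl fun ij _ => ?_
    ring

/-- The expected sum of `g n s` over `j` further independent draws of an arm of mean `m`, started
from `n` draws and `s` successes; the pair `(n, s)` is read off before each draw. -/
def futureCost (m : ℝ) (g : ℕ → ℕ → ℝ) : ℕ → ℕ → ℕ → ℝ
  | 0, _, _ => 0
  | j + 1, n, s =>
    g n s + m * futureCost m g j (n + 1) (s + 1) + (1 - m) * futureCost m g j (n + 1) s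

theorem futureCost_eq_sum (m : ℝ) (g : ℕ → ℕ → ℝ) (j n s : ℕ) :
    futureCost m g j n s =
      ∑ k ∈ range j, binomialExpect m k fun i => g (n + k) (s + i) := by
  induction j generalizing n s with
  | zero => simp [futureCost]
  | succ j ih =>
    rw [futureCost, ih, ih, sum_range_succ']
    simp only [binomialExpect_succ, sum_add_distrib, ← mul_sum]
    have h0 : binomialExpect m 0 (fun i => g (n + 0) (s + i)) = g n s := by
      simp [binomialExpect]
    have h1 (k i : ℕ) : g (n + 1 + k) (s + 1 + i) = g (n + (k + 1)) (s + (i + 1)) := by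
      congr 1 <;> ring
    have h2 (k i : ℕ) : g (n + 1 + k) (s + i) = g (n + (k + 1)) (s + i) := by
      congr 1; ring
    simp only [h0, h1, h2]
    ring

theorem binomialExpect_mono {m : ℝ} (h0 : 0 ≤ m) (h1 : m ≤ 1) {k : ℕ} {f g : ℕ → ℝ}
    (h : ∀ i ≤ k, f i ≤ g i) : binomialExpect m k f ≤ binomialExpect m k g := by
  refine sum_le_sum fun ij hij => ?_
  have : 0 ≤ 1 - m := by linarith
  have := h ij.1 (by have := mem_antidiagonal.1 hij; lia)
  gcongr

theorem binomialExpect_nonneg {m : ℝ} (h0 : 0 ≤ m) (h1 : m ≤ 1) {k : ℕ} {f : ℕ → ℝ}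
    (h : ∀ i ≤ k, 0 ≤ f i) : 0 ≤ binomialExpect m k f := by
  simpa [binomialExpect] using binomialExpect_mono (f := fun _ => 0) h0 h1 h

theorem binomialExpect_const (m : ℝ) (k : ℕ) (c : ℝ) : binomialExpect m k (fun _ => c) = c := by
  induction k with
  | zero => simp [binomialExpect]
  | succ k ih => rw [binomialExpect_succ, ih]; ring

theorem futureCost_le_succ {m : ℝ} (h0 : 0 ≤ m) (h1 : m ≤ 1) {g : ℕ → ℕ → ℝ}
    (hg : ∀ n s, s ≤ n → 0 ≤ g n s) (j : ℕ) {n s : ℕ} (hs : s ≤ n) :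
    futureCost m g j n s ≤ futureCost m g (j + 1) n s := by
  simp only [futureCost_eq_sum, sum_range_succ, le_add_iff_nonneg_right]
  exact binomialExpect_nonneg h0 h1 fun _ _ => hg _ _ (by lia)

/-- The expected cost of round `t + 1`, when drawing arm `a` after `n` draws of it that gave `s`
successes costs `g n s` and drawing another arm is free. -/
noncomputable def drawCost {K : ℕ} (π : Policy K) (μ : Fin K → unitInterval) (a : Fin K)
    (g : ℕ → ℕ → ℝ) (t : ℕ) : ℝ :=
  expect (historyLaw π μ t) fun h => g (draws h a) (successes h a) * (π t h a).toReal

/-- `futureCost` of the remaining rounds is a supermartingale along the run of any policy, once the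
cost already paid is added: it decreases in expectation by at least the cost of the current round,
whichever arm is drawn. -/
theorem expect_sum_draw_le_futureCost {K : ℕ} (π : Policy K) (μ : Fin K → unitInterval) (a : Fin K)
    {g : ℕ → ℕ → ℝ} (hg : ∀ n s, s ≤ n → 0 ≤ g n s) (j t : ℕ) :
    ∑ i ∈ range j, drawCost π μ a g (t + i) ≤
      expect (historyLaw π μ t) fun h =>
        futureCost (μ a) g j (draws h a) (successes h a) := by
  induction j generalizing t with
  | zero => simp [futureCost, expect_const]
  | succ j ih =>
    rw [sum_range_succ']
    have h1 := ih (t + 1)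
    rw [expect_historyLaw_succ] at h1
    have e (i : ℕ) : t + 1 + i = t + (i + 1) := by ring
    simp only [e] at h1
    refine (add_le_add_left h1 _).trans ?_
    rw [add_zero, drawCost, ← expect_add]
    refine expect_mono _ fun h => ?_
    have hm0 := (μ a).2.1
    have hm1 := (μ a).2.2
    set n := draws h a
    set s := successes h a
    have step (b : Fin K) : (π t h b).toReal *
        (μ b * futureCost (μ a) g j (draws (extend h b true) a) (successes (extend h b true) a) +
        (1 - μ b) * futureCost (μ a) g j (draws (extend h b false) a)
          (successes (extend h b false) a)) + (if b = a then g n s * (π t h a).toReal else 0) ≤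
        (π t h b).toReal * futureCost (μ a) g (j + 1) n s := by
      simp only [draws_extend, successes_extend]
      by_cases hb : b = a
      · subst hb
        simp only [↓reduceIte, true_and, futureCost, Bool.false_eq_true, add_zero]
        apply le_of_eq
        ring
      · simp only [hb, ↓reduceIte, false_and, add_zero]
        rw [← add_mul]
        have := futureCost_le_succ hm0 hm1 hg j (successes_le_draws h a)
        have h0 : 0 ≤ (π t h b).toReal := ENNReal.toReal_nonneg
        nlinarith
    have := sum_le_sum fun b (_ : b ∈ univ) => step b
    rw [sum_add_distrib] at this
    simpa [← sum_mul, sum_toReal_eq_one] using this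

/-- Charge `g n s` each time arm `a` is drawn after `n` draws of it that gave `s` successes. The
expected total charge is at most what it is when arm `a` is drawn in every round, where `s` is
binomial. -/
theorem expect_sum_draw_le_binomialExpect {K : ℕ} (π : Policy K) (μ : Fin K → unitInterval)
    (a : Fin K) {g : ℕ → ℕ → ℝ} (hg : ∀ n s, s ≤ n → 0 ≤ g n s) (T : ℕ) :
    ∑ t ∈ range T, drawCost π μ a g t ≤
      ∑ k ∈ range T, binomialExpect (μ a) k (g k) := by
  have h := expect_sum_draw_le_futureCost π μ a hg T 0
  simpa [futureCost_eq_sum, historyLaw, expect_pure, draws, successes] using h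

/-! ### The Bernoulli divergence -/

theorem klBernoulli_eq (p : ℝ) {q : ℝ} (h0 : q ≠ 0) (h1 : q ≠ 1) :
    klBernoulli p q =
      p * Real.log p - p * Real.log q +
        ((1 - p) * Real.log (1 - p) - (1 - p) * Real.log (1 - q)) := by
  have key (a b : ℝ) (hb : b ≠ 0) : a * Real.log (a / b) = a * Real.log a - a * Real.log b := by
    rcases eq_or_ne a 0 with rfl | ha
    · simp
    · rw [Real.log_div ha hb, mul_sub]
  rw [klBernoulli, key p q h0, key (1 - p) (1 - q) (sub_ne_zero.2 h1.symm)]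

theorem continuousAt_klBernoulli (p : ℝ) {q : ℝ} (h0 : 0 < q) (h1 : q < 1) :
    ContinuousAt (fun x : ℝ × ℝ => klBernoulli x.1 x.2) (p, q) := by
  have hev : ∀ᶠ x : ℝ × ℝ in 𝓝 (p, q), x.1 * Real.log x.1 - x.1 * Real.log x.2 +
      ((1 - x.1) * Real.log (1 - x.1) - (1 - x.1) * Real.log (1 - x.2)) =
      klBernoulli x.1 x.2 := by
    have : ∀ᶠ x : ℝ × ℝ in 𝓝 (p, q), x.2 ∈ Set.Ioo 0 1 :=
      continuous_snd.continuousAt.eventually_mem (Ioo_mem_nhds h0 h1)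
    filter_upwards [this] with x hx
    rw [klBernoulli_eq _ hx.1.ne' hx.2.ne]
  refine ContinuousAt.congr ?_ hev
  have c1 : ContinuousAt (fun x : ℝ × ℝ => x.1 * Real.log x.1) (p, q) :=
    (Real.continuous_mul_log.comp continuous_fst).continuousAt
  have c2 : ContinuousAt (fun x : ℝ × ℝ => (1 - x.1) * Real.log (1 - x.1)) (p, q) :=
    (Real.continuous_mul_log.comp (continuous_const.sub continuous_fst)).continuousAt
  have c3 : ContinuousAt (fun x : ℝ × ℝ => Real.log x.2) (p, q) :=
    continuous_snd.continuousAt.log h0.ne'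
  have c4 : ContinuousAt (fun x : ℝ × ℝ => Real.log (1 - x.2)) (p, q) :=
    (continuous_const.sub continuous_snd).continuousAt.log (sub_pos.2 h1).ne'
  have c5 : ContinuousAt (fun x : ℝ × ℝ => x.1) (p, q) := continuous_fst.continuousAt
  exact (c1.sub (c5.mul c3)).add (c2.sub ((continuousAt_const.sub c5).mul c4))

theorem klBernoulli_pos {p q : ℝ} (hp0 : 0 ≤ p) (hp1 : p < 1) (hq0 : 0 < q) (hq1 : q < 1)
    (hpq : p ≠ q) : 0 < klBernoulli p q := by
  have key (a b : ℝ) (ha : 0 < a) (hb : 0 < b) (hab : a ≠ b) :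
      a - b < a * Real.log (a / b) := by
    have h1 : Real.log (b / a) < b / a - 1 :=
      Real.log_lt_sub_one_of_pos (div_pos hb ha) fun h => hab (by field_simp at h; exact h.symm)
    have h2 : Real.log (a / b) = -Real.log (b / a) := by rw [← Real.log_inv, inv_div]
    have h3 := mul_lt_mul_of_pos_left h1 ha
    have h4 : a * (b / a - 1) = b - a := by field_simp
    rw [h2]
    linarith
  have h2 := key (1 - p) (1 - q) (by linarith) (by linarith) fun h => hpq (by linarith)
  rw [klBernoulli]
  rcases hp0.eq_or_lt with rfl | hp
  · simp at h2 ⊢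
    linarith
  · have h1 := key p q hp hq0 hpq
    linarith

theorem klBernoulli_one_sub (p q : ℝ) : klBernoulli (1 - p) (1 - q) = klBernoulli p q := by
  simp only [klBernoulli, sub_sub_cancel]
  ring

theorem klBernoulli_mono_right {x y u : ℝ} (hx : 0 < x) (hxy : x ≤ y) (hyu : y ≤ u) (hu : u < 1) :
    klBernoulli x y ≤ klBernoulli x u := by
  have hy : 0 < y := hx.trans_le hxy
  have hu0 : 0 < u := hy.trans_le hyu
  rw [klBernoulli_eq x hy.ne' (hyu.trans_lt hu).ne, klBernoulli_eq x hu0.ne' hu.ne]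
  have h1 : Real.log u - Real.log y ≤ u / y - 1 := by
    rw [← Real.log_div hu0.ne' hy.ne']
    exact Real.log_le_sub_one_of_pos (by positivity)
  have hy1 : 0 < 1 - y := by linarith
  have hu1 : 0 < 1 - u := by linarith
  have h2 : Real.log (1 - u) - Real.log (1 - y) ≤ (1 - u) / (1 - y) - 1 := by
    rw [← Real.log_div hu1.ne' hy1.ne']
    exact Real.log_le_sub_one_of_pos (by positivity)
  have h3 : x * (u / y - 1) + (1 - x) * ((1 - u) / (1 - y) - 1) ≤ 0 := by
    have : x * (u / y - 1) + (1 - x) * ((1 - u) / (1 - y) - 1) =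
        -((u - y) * (y - x) / (y * (1 - y))) := by
      field_simp
      ring
    rw [this, neg_nonpos]
    exact div_nonneg (mul_nonneg (by linarith) (by linarith)) (by positivity)
  have h4 := mul_le_mul_of_nonneg_left h1 hx.le
  have h5 := mul_le_mul_of_nonneg_left h2 (show 0 ≤ 1 - x by linarith)
  linarith

/-! ### Chernoff bounds for binomial probabilities -/

theorem choose_mul_pow_mul_pow_le_one {x : ℝ} (h0 : 0 ≤ x) (h1 : x ≤ 1) (i j : ℕ) :
    ((i + j).choose i : ℝ) * (x ^ i * (1 - x) ^ j) ≤ 1 := by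
  have h2 : 0 ≤ 1 - x := by linarith
  have := single_le_sum (s := antidiagonal (i + j))
    (f := fun ij => ((i + j).choose ij.1 : ℝ) * (x ^ ij.1 * (1 - x) ^ ij.2 * 1))
    (fun _ _ => by positivity) (mem_antidiagonal.2 (rfl : (i, j).1 + (i, j).2 = i + j))
  have e := binomialExpect_const x (i + j) 1
  rw [binomialExpect] at e
  rw [e] at this
  simpa using this

/-- If `i ≤ z (i + j)`, then `a ^ i * b ^ j` with `b ≤ a` is largest at the ratio `z : 1 - z`. -/
theorem mul_log_add_mul_log_le {a b z : ℝ} (hab : Real.log b ≤ Real.log a) {i j : ℕ}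
    (hi : (i : ℝ) ≤ z * (i + j)) :
    i * Real.log a + j * Real.log b ≤ (i + j) * (z * Real.log a + (1 - z) * Real.log b) := by
  nlinarith

theorem choose_mul_pow_mul_pow_le_exp_self {x u : ℝ} (hx : 0 < x) (hxu : x ≤ u) (hu : u < 1)
    {i j : ℕ} (hi : (i : ℝ) ≤ x * (i + j)) :
    ((i + j).choose i : ℝ) * (u ^ i * (1 - u) ^ j) ≤
      Real.exp (-((i + j) * klBernoulli x u)) := by
  have hu0 : 0 < u := hx.trans_le hxu
  have hx1 : 0 < 1 - x := by linarith
  have hu1 : 0 < 1 - u := by linarith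
  have h1 := choose_mul_pow_mul_pow_le_one hx.le (by linarith) i j
  have h2 : (u / x) ^ i * ((1 - u) / (1 - x)) ^ j ≤ Real.exp (-((i + j) * klBernoulli x u)) := by
    have ha : 0 < u / x := by positivity
    have hb : 0 < (1 - u) / (1 - x) := by positivity
    rw [← Real.log_le_iff_le_exp (by positivity), Real.log_mul (by positivity) (by positivity),
      Real.log_pow, Real.log_pow]
    refine (mul_log_add_mul_log_le (Real.log_le_log hb ?_) hi).trans (le_of_eq ?_)
    · exact ((div_le_one hx1).2 (by linarith)).trans ((one_le_div hx).2 hxu)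
    · rw [klBernoulli_eq x hu0.ne' hu.ne, Real.log_div hu0.ne' hx.ne',
        Real.log_div hu1.ne' hx1.ne']
      ring
  calc ((i + j).choose i : ℝ) * (u ^ i * (1 - u) ^ j)
      = ((i + j).choose i : ℝ) * (x ^ i * (1 - x) ^ j) *
        ((u / x) ^ i * ((1 - u) / (1 - x)) ^ j) := by
        simp only [div_pow]
        field_simp
    _ ≤ 1 * ((u / x) ^ i * ((1 - u) / (1 - x)) ^ j) := by gcongr
    _ ≤ _ := by rwa [one_mul]

/-- Lower tail: at most a fraction `x` of successes, for a success probability at least `y ≥ x`. -/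
theorem choose_mul_pow_mul_pow_le_exp {x y u : ℝ} (hx : 0 < x) (hxy : x ≤ y) (hyu : y ≤ u)
    (hy : y < 1) (hu : u ≤ 1) {i j : ℕ} (hi : (i : ℝ) ≤ x * (i + j)) :
    ((i + j).choose i : ℝ) * (u ^ i * (1 - u) ^ j) ≤
      Real.exp (-((i + j) * klBernoulli x y)) := by
  rcases hu.eq_or_lt with rfl | hu
  · rcases Nat.eq_zero_or_pos j with rfl | hj
    · have : (i : ℝ) = 0 := by
        have : (0 : ℝ) ≤ i := by positivity
        push_cast at hi
        nlinarith
      have hi0 : i = 0 := by exact_mod_cast this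
      simp [hi0]
    · simp [hj.ne', Real.exp_nonneg]
  · refine (choose_mul_pow_mul_pow_le_exp_self hx (hxy.trans hyu) hu hi).trans ?_
    have := klBernoulli_mono_right hx hxy hyu hu
    gcongr

/-- Upper tail: at least a fraction `x` of successes, for a success probability at most `y ≤ x`. -/
theorem choose_mul_pow_mul_pow_le_exp' {x y u : ℝ} (hx : x < 1) (hxy : y ≤ x) (hyu : u ≤ y)
    (hy : 0 < y) (hu : 0 ≤ u) {i j : ℕ} (hi : x * (i + j) ≤ i) :
    ((i + j).choose i : ℝ) * (u ^ i * (1 - u) ^ j) ≤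
      Real.exp (-((i + j) * klBernoulli x y)) := by
  have := choose_mul_pow_mul_pow_le_exp (x := 1 - x) (y := 1 - y) (u := 1 - u) (i := j) (j := i)
    (by linarith) (by linarith) (by linarith) (by linarith) (by linarith) (by linarith)
  rw [klBernoulli_one_sub, sub_sub_cancel] at this
  rw [Nat.choose_symm_add, add_comm i j, add_comm (i : ℝ), mul_comm (u ^ i)]
  exact this

theorem summable_succ_mul_exp_neg {c : ℝ} (hc : 0 < c) :
    Summable fun k : ℕ => ((k : ℝ) + 1) * Real.exp (-(k * c)) := by
  have h1 := Real.summable_pow_mul_exp_neg_nat_mul 1 hc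
  have h0 := Real.summable_pow_mul_exp_neg_nat_mul 0 hc
  refine (h1.add h0).congr fun k => ?_
  rw [show -c * (k : ℝ) = -(k * c) by ring]
  ring

theorem summable_succ_sq_mul_exp_neg {c : ℝ} (hc : 0 < c) :
    Summable fun k : ℕ => ((k : ℝ) + 1) ^ 2 * Real.exp (-(k * c)) := by
  have h2 := Real.summable_pow_mul_exp_neg_nat_mul 2 hc
  have h1 := Real.summable_pow_mul_exp_neg_nat_mul 1 hc
  have h0 := Real.summable_pow_mul_exp_neg_nat_mul 0 hc
  refine ((h2.add (h1.mul_left 2)).add h0).congr fun k => ?_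
  rw [show -c * (k : ℝ) = -(k * c) by ring]
  ring

theorem binomialExpect_le_of_term_le {m : ℝ} {k : ℕ} {f : ℕ → ℝ} {B : ℝ}
    (h : ∀ i j, i + j = k → ((i + j).choose i : ℝ) * (m ^ i * (1 - m) ^ j * f i) ≤ B) :
    binomialExpect m k f ≤ (k + 1) * B := by
  refine (sum_le_card_nsmul _ _ B fun ij hij => ?_).trans (le_of_eq ?_)
  · have := mem_antidiagonal.1 hij
    rw [← this]
    exact h _ _ this
  · simp

/-- The probabilities that the success rate of `k` trials exceeds a level above the mean are
summable. -/
theorem summable_binomialExpect_lt {m x : ℝ} (h0 : 0 ≤ m) (hmx : m < x) (hx : x < 1) :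
    Summable fun k : ℕ => binomialExpect m k fun i => if x * k < i then 1 else 0 := by
  have hy : m < (m + x) / 2 := by linarith
  have hyx : (m + x) / 2 < x := by linarith
  have hc := klBernoulli_pos (p := x) (q := (m + x) / 2) (by linarith) hx (by linarith)
    (by linarith) hyx.ne'
  refine (summable_succ_mul_exp_neg hc).of_nonneg_of_le
    (fun k => binomialExpect_nonneg h0 (by linarith) fun i _ => by positivity) fun k => ?_
  refine binomialExpect_le_of_term_le fun i j hij => ?_
  split_ifs with hi
  · have := choose_mul_pow_mul_pow_le_exp' (u := m) (i := i) (j := j) hx hyx.le hy.le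
      (by linarith) h0 (by rw [← hij] at hi; push_cast at hi; exact hi.le)
    rw [mul_one, ← hij]
    push_cast
    exact this
  · simp [Real.exp_nonneg]

/-! ### Tails of the posterior -/

theorem betaPDFReal_natCast_succ (s j : ℕ) {u : ℝ} (h0 : 0 < u) (h1 : u < 1) :
    betaPDFReal (s + 1) (j + 1) u =
      (s + j + 1) * (((s + j).choose s : ℝ) * (u ^ s * (1 - u) ^ j)) := by
  rw [betaPDFReal, if_pos ⟨h0, h1⟩, beta, Real.Gamma_nat_eq_factorial, Real.Gamma_nat_eq_factorial,
    show (s : ℝ) + 1 + (j + 1) = ((s + j + 1 : ℕ) : ℝ) + 1 by push_cast; ring,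
    Real.Gamma_nat_eq_factorial, Nat.factorial_succ, add_sub_cancel_right, add_sub_cancel_right,
    Real.rpow_natCast, Real.rpow_natCast]
  have h := Nat.add_choose_mul_factorial_mul_factorial s j
  rw [← Nat.choose_symm_add] at h
  have h' : ((s + j).choose s : ℝ) * s.factorial * j.factorial = (s + j).factorial := by
    exact_mod_cast h
  have hs : (s.factorial : ℝ) ≠ 0 := by positivity
  have hj : (j.factorial : ℝ) ≠ 0 := by positivity
  push_cast
  rw [← h']
  field_simp

theorem betaMeasure_real_le (s j : ℕ) {A : Set ℝ} (hA : MeasurableSet A) {M : ℝ} (hM : 0 ≤ M)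
    (h : ∀ u ∈ A, 0 < u → u < 1 → ((s + j).choose s : ℝ) * (u ^ s * (1 - u) ^ j) ≤ M) :
    (betaMeasure (s + 1) (j + 1)).real A ≤ (s + j + 1) * M := by
  refine ENNReal.toReal_le_of_le_ofReal (by positivity) ?_
  rw [betaMeasure, withDensity_apply _ hA]
  calc ∫⁻ u in A, betaPDF (s + 1) (j + 1) u
      ≤ ∫⁻ u in A, (Set.Ioo (0 : ℝ) 1).indicator
          (fun _ => ENNReal.ofReal ((s + j + 1) * M)) u := by
        refine setLIntegral_mono' hA fun u hu => ?_
        by_cases hu' : u ∈ Set.Ioo (0 : ℝ) 1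
        · rw [Set.indicator_of_mem hu', betaPDF, betaPDFReal_natCast_succ s j hu'.1 hu'.2]
          have := h u hu hu'.1 hu'.2
          gcongr
        · have : ¬(0 < u ∧ u < 1) := hu'
          rw [Set.indicator_of_notMem hu', betaPDF_eq, if_neg this, ENNReal.ofReal_zero]
    _ ≤ ∫⁻ u, (Set.Ioo (0 : ℝ) 1).indicator (fun _ => ENNReal.ofReal ((s + j + 1) * M)) u :=
        setLIntegral_le_lintegral _ _
    _ = ENNReal.ofReal ((s + j + 1) * M) := by
        rw [lintegral_indicator_const measurableSet_Ioo]
        simp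

theorem le_betaMeasure_real_Ioi (s j : ℕ) {y z : ℝ} (hy : 0 < y) (hz : z < 1) :
    (s + j + 1) * (((s + j).choose s : ℝ) * (y ^ s * (1 - z) ^ j)) * (z - y) ≤
      (betaMeasure (s + 1) (j + 1)).real (Set.Ioi y) := by
  have := isProbabilityMeasureBeta (α := s + 1) (β := j + 1) (by positivity) (by positivity)
  have hz1 : 0 ≤ 1 - z := by linarith
  refine (ENNReal.ofReal_le_iff_le_toReal (measure_ne_top _ _)).1 ?_
  rw [betaMeasure, withDensity_apply _ measurableSet_Ioi,
    ENNReal.ofReal_mul (by positivity), ← Real.volume_Ioo, ← lintegral_indicator measurableSet_Ioi,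
    ← lintegral_indicator_const measurableSet_Ioo]
  refine lintegral_mono fun u => ?_
  by_cases hu : u ∈ Set.Ioo y z
  · rw [Set.indicator_of_mem hu, Set.indicator_of_mem (Set.mem_Ioi.2 hu.1), betaPDF,
      betaPDFReal_natCast_succ s j (hy.trans hu.1) (hu.2.trans hz)]
    have := hu.1.le
    have := hu.2.le
    have : 0 ≤ u := by linarith
    gcongr
  · rw [Set.indicator_of_notMem hu]
    exact zero_le

/-- The probability that a sample from the posterior exceeds `y`, after `n` draws of the arm that
gave `s` successes. -/
noncomputable def posteriorTail (y : ℝ) (n s : ℕ) : ℝ :=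
  (betaMeasure (s + 1 : ℝ) ((n : ℝ) - s + 1)).real (Set.Ioi y)

theorem posteriorTail_add (y : ℝ) (s j : ℕ) :
    posteriorTail y (s + j) s = (betaMeasure (s + 1) (j + 1)).real (Set.Ioi y) := by
  rw [posteriorTail]
  push_cast
  rw [add_sub_cancel_left]

theorem posteriorTail_pos {y : ℝ} (hy0 : 0 < y) (hy1 : y < 1) {n s : ℕ} (hs : s ≤ n) :
    0 < posteriorTail y n s := by
  obtain ⟨j, rfl⟩ := Nat.exists_eq_add_of_le hs
  obtain ⟨z, hyz, hz⟩ := exists_between hy1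
  rw [posteriorTail_add]
  have := sub_pos.2 hyz
  have := sub_pos.2 hz
  have hc : (0 : ℝ) < (s + j).choose s := by exact_mod_cast Nat.choose_pos (Nat.le_add_right s j)
  exact (by positivity : (0 : ℝ) < _).trans_le (le_betaMeasure_real_Ioi s j hy0 hz)

theorem posteriorTail_le_one (y : ℝ) {n s : ℕ} (hs : s ≤ n) : posteriorTail y n s ≤ 1 := by
  obtain ⟨j, rfl⟩ := Nat.exists_eq_add_of_le hs
  have := isProbabilityMeasureBeta (α := s + 1) (β := j + 1) (by positivity) (by positivity)
  rw [posteriorTail_add]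
  exact measureReal_le_one

theorem posteriorTail_le_exp {x y : ℝ} (hx : 0 < x) (hxy : x ≤ y) (hy : y < 1) {n s : ℕ}
    (hsn : s ≤ n) (hs : (s : ℝ) ≤ x * n) :
    posteriorTail y n s ≤ (n + 1) * Real.exp (-(n * klBernoulli x y)) := by
  obtain ⟨j, rfl⟩ := Nat.exists_eq_add_of_le hsn
  push_cast at hs
  rw [posteriorTail_add]
  push_cast
  refine betaMeasure_real_le s j measurableSet_Ioi (Real.exp_nonneg _) fun u hu _ hu1 => ?_
  exact choose_mul_pow_mul_pow_le_exp hx hxy (le_of_lt hu) hy hu1.le hs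

theorem one_sub_posteriorTail_le_exp {x y : ℝ} (hx : x < 1) (hxy : y ≤ x) (hy : 0 < y) {n s : ℕ}
    (hsn : s ≤ n) (hs : x * n ≤ s) :
    1 - posteriorTail y n s ≤ (n + 1) * Real.exp (-(n * klBernoulli x y)) := by
  obtain ⟨j, rfl⟩ := Nat.exists_eq_add_of_le hsn
  push_cast at hs
  have := isProbabilityMeasureBeta (α := s + 1) (β := j + 1) (by positivity) (by positivity)
  rw [posteriorTail_add, ← probReal_compl_eq_one_sub measurableSet_Ioi, Set.compl_Ioi]
  push_cast
  refine betaMeasure_real_le s j measurableSet_Iic (Real.exp_nonneg _) fun u hu hu0 _ => ?_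
  exact choose_mul_pow_mul_pow_le_exp' hx hxy hu hy hu0.le hs

/-- At `z = y` the expression is the negative of the divergence of `m` from `y`. -/
theorem exists_mul_log_add_mul_log_neg {y m : ℝ} (hy : 0 < y) (hym : y < m) (hm : m < 1) :
    ∃ z, y < z ∧ z < m ∧ z * Real.log (m / y) + (1 - z) * Real.log ((1 - m) / (1 - z)) < 0 := by
  have hneg : y * Real.log (m / y) + (1 - y) * Real.log ((1 - m) / (1 - y)) < 0 := by
    have := klBernoulli_pos hy.le (hym.trans hm) (hy.trans hym) hm hym.ne
    rw [klBernoulli, ← inv_div m y, ← inv_div (1 - m) (1 - y), Real.log_inv, Real.log_inv] at this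
    linarith
  have hcont : ContinuousAt
      (fun z => z * Real.log (m / y) + (1 - z) * Real.log ((1 - m) / (1 - z))) y := by
    have h1 : (1 - y) ≠ 0 := by linarith
    have h2 : (1 - m) / (1 - y) ≠ 0 := div_ne_zero (by linarith) h1
    fun_prop (disch := assumption)
  have h1 : ∀ᶠ z in 𝓝[>] y,
      z * Real.log (m / y) + (1 - z) * Real.log ((1 - m) / (1 - z)) < 0 :=
    (hcont.eventually_lt continuousAt_const hneg).filter_mono nhdsWithin_le_nhds
  have h2 : ∀ᶠ z in 𝓝[>] y, z ∈ Set.Ioo y m := Ioo_mem_nhdsGT hym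
  obtain ⟨z, hz1, hz2⟩ := (h1.and h2).exists
  exact ⟨z, hz2.1, hz2.2, hz1⟩

/-- For an arm of mean `m`, drawn `k` times, and a level `y < m`, the odds that a sample from the
posterior does not exceed `y` are summable over `k` in expectation.

Few successes make the odds large, but they are unlikely enough: the probability of `i` successes is
proportional to the value at `m` of the posterior density, up to a polynomial factor, whereas the
probability of exceeding `y` involves its larger values between `y` and some `z < m`. -/
theorem summable_binomialExpect_odds {y m : ℝ} (hy : 0 < y) (hym : y < m) (hm : m < 1) :
    Summable fun k : ℕ => binomialExpect m k fun i =>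
      (1 - posteriorTail y k i) / posteriorTail y k i := by
  obtain ⟨z, hyz, hzm, hneg⟩ := exists_mul_log_add_mul_log_neg hy hym hm
  set c₁ := -(z * Real.log (m / y) + (1 - z) * Real.log ((1 - m) / (1 - z))) with hc₁
  have hc₁_pos : 0 < c₁ := by linarith
  set c₂ := klBernoulli z y with hc₂
  have hc₂_pos : 0 < c₂ := klBernoulli_pos (by linarith) (by linarith) hy (by linarith) hyz.ne'
  have hm0 : 0 < m := hy.trans hym
  have hm1 : 0 < 1 - m := by linarith
  have hz1 : 0 < 1 - z := by linarith
  have hd : 0 < z - y := by linarith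
  have hbound : Summable fun k : ℕ =>
      ((k : ℝ) + 1) * (Real.exp (-(k * c₁)) / (z - y) +
        2 * ((k + 1) * Real.exp (-(k * c₂)))) := by
    refine (((summable_succ_mul_exp_neg hc₁_pos).mul_right (1 / (z - y))).add
      ((summable_succ_sq_mul_exp_neg hc₂_pos).mul_left 2)).congr fun k => ?_
    ring
  have hsmall : ∀ᶠ k : ℕ in atTop, ((k : ℝ) + 1) * Real.exp (-(k * c₂)) < 1 / 2 :=
    (summable_succ_mul_exp_neg hc₂_pos).tendsto_atTop_zero.eventually_lt_const (by norm_num)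
  refine hbound.of_norm_bounded_eventually_nat ?_
  filter_upwards [hsmall] with k hk
  have hodds (i : ℕ) (hi : i ≤ k) : 0 ≤ (1 - posteriorTail y k i) / posteriorTail y k i :=
    div_nonneg (sub_nonneg.2 (posteriorTail_le_one y hi))
      (posteriorTail_pos hy (hym.trans hm) hi).le
  rw [Real.norm_of_nonneg (binomialExpect_nonneg hm0.le hm.le hodds)]
  refine binomialExpect_le_of_term_le fun i j hij => ?_
  have hik : i ≤ k := by lia
  have hp := posteriorTail_pos hy (hym.trans hm) hik
  have hkij : (k : ℝ) = i + j := by exact_mod_cast hij.symm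
  rcases le_total (i : ℝ) (z * k) with hi | hi
  -- Few successes: the likelihood of the data at `m` is exponentially smaller than between `y`, `z`.
  · refine le_add_of_le_of_nonneg ?_ (by positivity)
    have hlow := le_betaMeasure_real_Ioi i j hy (hzm.trans hm)
    rw [← posteriorTail_add, hij] at hlow
    have hc : (0 : ℝ) < (i + j).choose i := by
      exact_mod_cast Nat.choose_pos (Nat.le_add_right i j)
    have hexp : (m / y) ^ i * ((1 - m) / (1 - z)) ^ j ≤ Real.exp (-(k * c₁)) := by
      rw [← Real.log_le_iff_le_exp (by positivity), Real.log_mul (by positivity) (by positivity),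
        Real.log_pow, Real.log_pow]
      refine (mul_log_add_mul_log_le (Real.log_le_log (by positivity) ?_)
        (by rwa [← hkij])).trans (le_of_eq ?_)
      · exact ((div_le_one hz1).2 (by linarith)).trans ((one_le_div hy).2 hym.le)
      · rw [hc₁, ← hkij]
        ring
    rw [← hij] at hlow
    calc ((i + j).choose i : ℝ) * (m ^ i * (1 - m) ^ j *
          ((1 - posteriorTail y k i) / posteriorTail y k i))
        ≤ ((i + j).choose i : ℝ) * (m ^ i * (1 - m) ^ j *
          (1 / (((i + j).choose i : ℝ) * (y ^ i * (1 - z) ^ j) * (z - y)))) := by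
          have h1 : ((i + j).choose i : ℝ) * (y ^ i * (1 - z) ^ j) * (z - y) ≤
              posteriorTail y k i := by
            rw [← hij]
            have hX : 0 ≤ ((i : ℝ) + j) *
                (((i + j).choose i : ℝ) * (y ^ i * (1 - z) ^ j) * (z - y)) := by positivity
            linarith
          gcongr
          linarith
      _ = (m / y) ^ i * ((1 - m) / (1 - z)) ^ j / (z - y) := by
          simp only [div_pow]
          field_simp
      _ ≤ _ := by gcongr
  -- Many successes: the odds themselves are exponentially small.
  · refine le_add_of_nonneg_of_le (by positivity) ?_
    have h1 := one_sub_posteriorTail_le_exp (hzm.trans hm) hyz.le hy hik hi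
    have hhalf : 1 / 2 ≤ posteriorTail y k i := by linarith
    have h2 : (1 - posteriorTail y k i) / posteriorTail y k i ≤
        2 * ((k + 1) * Real.exp (-(k * c₂))) := by
      rw [div_le_iff₀ hp]
      have : 0 ≤ ((k : ℝ) + 1) * Real.exp (-(k * c₂)) := by positivity
      nlinarith
    rw [← mul_assoc]
    calc _ ≤ 1 * ((1 - posteriorTail y k i) / posteriorTail y k i) := by
          have := hodds i hik
          have := choose_mul_pow_mul_pow_le_one hm0.le hm.le i j
          gcongr
      _ ≤ _ := by rwa [one_mul]

/-! ### The choice made by Thompson Sampling -/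

theorem argmax_eq_of_lt {K : ℕ} [NeZero K] {θ : Fin K → ℝ} {a : Fin K}
    (h : ∀ b, b ≠ a → θ b < θ a) : argmax θ = a := by
  have hm : argmax θ ∈ maximizers θ := min'_mem _ _
  by_contra hne
  exact absurd ((mem_filter.1 hm).2 a) (not_le.2 (h _ hne))

theorem le_argmax {K : ℕ} [NeZero K] (θ : Fin K → ℝ) (b : Fin K) : θ b ≤ θ (argmax θ) := by
  have hm : argmax θ ∈ maximizers θ := min'_mem _ _
  exact (mem_filter.1 hm).2 b

theorem thompsonSampling_toReal {K t : ℕ} [NeZero K] (h : History K t) (a : Fin K) :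
    (thompsonSampling K t h a).toReal = (Measure.pi (posterior h)).real (argmax ⁻¹' {a}) := by
  rw [thompsonSampling, Measure.toPMF_apply,
    Measure.map_apply measurable_argmax (measurableSet_singleton a), measureReal_def]

theorem pi_real_pi {ι : Type} [Fintype ι] (ν : ι → Measure ℝ) [∀ i, IsProbabilityMeasure (ν i)]
    (s : ι → Set ℝ) : (Measure.pi ν).real (Set.univ.pi s) = ∏ i, (ν i).real (s i) := by
  simp [measureReal_def, Measure.pi_pi, ENNReal.toReal_prod]

/-- Thompson Sampling draws arm `a` either because the sample of `a` exceeds `y`, or while no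
sample exceeds `y`. If the sample of `o` is then replaced by one that exceeds `y`, arm `o` is drawn
instead, so the probability of the second case is at most the odds that the sample of `o` does not
exceed `y`, times the probability to draw `o`. -/
theorem thompsonSampling_le {K t : ℕ} [NeZero K] (h : History K t) (a o : Fin K)
    {y : ℝ} (hy0 : 0 < y) (hy1 : y < 1) :
    (thompsonSampling K t h a).toReal ≤ posteriorTail y (draws h a) (successes h a) +
      (1 - posteriorTail y (draws h o) (successes h o)) /
        posteriorTail y (draws h o) (successes h o) * (thompsonSampling K t h o).toReal := by
  classical
  set ν := posterior h
  set p := posteriorTail y (draws h o) (successes h o) with hp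
  have hp0 : 0 < p := posteriorTail_pos hy0 hy1 (successes_le_draws h o)
  have hp1 : p ≤ 1 := posteriorTail_le_one y (successes_le_draws h o)
  have hp' : p = (ν o).real (Set.Ioi y) := rfl
  have hq : 1 - p = (ν o).real (Set.Iic y) := by
    rw [hp', ← probReal_compl_eq_one_sub measurableSet_Ioi, Set.compl_Ioi]
  set M := ∏ b ∈ univ.erase o, (ν b).real (Set.Iic y)
  have hA : (Measure.pi ν).real {θ | y < θ a} =
      posteriorTail y (draws h a) (successes h a) :=
    (measurePreserving_eval ν a).measureReal_preimage measurableSet_Ioi.nullMeasurableSet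
  have hB : (Measure.pi ν).real (Set.univ.pi fun _ => Set.Iic y) = (1 - p) * M := by
    rw [pi_real_pi, ← mul_prod_erase univ _ (mem_univ o), hq]
  have hG : (Measure.pi ν).real
      (Set.univ.pi fun b => if b = o then Set.Ioi y else Set.Iic y) = p * M := by
    rw [pi_real_pi, ← mul_prod_erase univ _ (mem_univ o), if_pos rfl, hp']
    congr 1
    exact prod_congr rfl fun b hb => by rw [if_neg (ne_of_mem_erase hb)]
  have h1 : (thompsonSampling K t h a).toReal ≤
      posteriorTail y (draws h a) (successes h a) + (1 - p) * M := by
    rw [thompsonSampling_toReal, ← hA, ← hB]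
    refine (measureReal_mono ?_).trans (measureReal_union_le _ _)
    intro θ hθ
    have hθ' : argmax θ = a := hθ
    by_cases hya : y < θ a
    · exact Or.inl hya
    · exact Or.inr fun b _ => (le_argmax θ b).trans (hθ' ▸ not_lt.1 hya)
  have h2 : p * M ≤ (thompsonSampling K t h o).toReal := by
    rw [thompsonSampling_toReal, ← hG]
    refine measureReal_mono ?_
    intro θ hθ
    refine argmax_eq_of_lt fun b hb => ?_
    have hb' := hθ b trivial
    have ho' := hθ o trivial
    simp only [hb, ↓reduceIte, Set.mem_Iic, Set.mem_Ioi] at hb' ho'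
    exact hb'.trans_lt ho'
  refine h1.trans (add_le_add_right ?_ _)
  calc (1 - p) * M = (1 - p) / p * (p * M) := by field_simp
    _ ≤ _ := mul_le_mul_of_nonneg_left h2 (div_nonneg (by linarith) hp0.le)

/-! ### The logarithmic upper bound -/

theorem le_bestMean {K : ℕ} (μ : Fin K → unitInterval) (a : Fin K) : (μ a : ℝ) ≤ bestMean μ :=
  le_ciSup (f := fun a => (μ a : ℝ)) (Set.finite_range _).bddAbove a

theorem exists_eq_bestMean {K : ℕ} [NeZero K] (μ : Fin K → unitInterval) :
    ∃ o, (μ o : ℝ) = bestMean μ :=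
  exists_eq_ciSup_of_finite

theorem bestMean_lt_one {K : ℕ} [NeZero K] {μ : Fin K → unitInterval}
    (hμ : ∀ a, (μ a : ℝ) < 1) : bestMean μ < 1 := by
  obtain ⟨o, ho⟩ := exists_eq_bestMean μ
  exact ho ▸ hμ o

theorem klBernoulli_bestMean_pos {K : ℕ} [NeZero K] {μ : Fin K → unitInterval}
    (hμ : ∀ a, (μ a : ℝ) < 1) {a : Fin K} (ha : (μ a : ℝ) ≠ bestMean μ) :
    0 < klBernoulli (μ a) (bestMean μ) :=
  klBernoulli_pos (μ a).2.1 (hμ a)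
    ((μ a).2.1.trans_lt (lt_of_le_of_ne (le_bestMean μ a) ha)) (bestMean_lt_one hμ) ha

theorem exists_levels {p q κ : ℝ} (hpq : p < q) (hq0 : 0 < q) (hq1 : q < 1)
    (hκ : κ < klBernoulli p q) : ∃ x y, p < x ∧ x < y ∧ y < q ∧ κ < klBernoulli x y := by
  have hc : Tendsto (fun η : ℝ => klBernoulli (p + η) (q - η)) (𝓝[>] 0)
      (𝓝 (klBernoulli p q)) := by
    have h1 : Tendsto (fun η : ℝ => (p + η, q - η)) (𝓝[>] 0) (𝓝 (p, q)) := by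
      have : Continuous fun η : ℝ => (p + η, q - η) := by fun_prop
      simpa using (this.tendsto 0).mono_left nhdsWithin_le_nhds
    exact (continuousAt_klBernoulli p hq0 hq1).tendsto.comp h1
  have h2 : ∀ᶠ η : ℝ in 𝓝[>] 0, η ∈ Set.Ioo 0 ((q - p) / 2) :=
    Ioo_mem_nhdsGT (by linarith)
  obtain ⟨η, h3, h4, h5⟩ := ((hc.eventually_const_lt hκ).and h2).exists
  exact ⟨p + η, q - η, by linarith, by linarith, by linarith, h3⟩

theorem succ_mul_exp_neg_le {d : ℝ} (hd : 0 < d) (n : ℕ) :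
    ((n : ℝ) + 1) * Real.exp (-(n * d)) ≤ 1 / d + 1 := by
  have h1 : n * d + 1 ≤ Real.exp (n * d) := Real.add_one_le_exp _
  have h2 : (1 : ℝ) ≤ Real.exp (n * d) := Real.one_le_exp (by positivity)
  rw [Real.exp_neg, ← div_eq_mul_inv, div_le_iff₀ (Real.exp_pos _)]
  have h3 : (n : ℝ) ≤ 1 / d * Real.exp (n * d) := by
    rw [one_div, ← div_eq_inv_mul, le_div_iff₀ hd]
    linarith
  linarith

theorem binomialExpect_add (m : ℝ) (k : ℕ) (f g : ℕ → ℝ) :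
    binomialExpect m k (fun i => f i + g i) = binomialExpect m k f + binomialExpect m k g := by
  simp only [binomialExpect, ← sum_add_distrib]
  exact sum_congr rfl fun _ _ => by ring

theorem sum_ite_lt_le {L : ℝ} (hL : 0 ≤ L) (T : ℕ) :
    ∑ k ∈ range T, (if (k : ℝ) < L then (1 : ℝ) else 0) ≤ L + 1 := by
  rw [sum_boole]
  have h1 : #((range T).filter fun k : ℕ => (k : ℝ) < L) ≤ #(range ⌈L⌉₊) :=
    card_le_card fun k hk => mem_range.2 (Nat.lt_ceil.2 (mem_filter.1 hk).2)
  rw [card_range] at h1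
  exact (Nat.cast_le.2 h1).trans (Nat.ceil_lt_add_one hL).le

/-- A suboptimal arm `a` is drawn at most `ln T / κ + C` times in expectation, for every `κ` below
its divergence from the best arm. -/
theorem exists_expectedDraws_le {K : ℕ} [NeZero K] {μ : Fin K → unitInterval}
    (hμ : ∀ a, (μ a : ℝ) < 1) {a : Fin K} (ha : (μ a : ℝ) ≠ bestMean μ) {κ : ℝ} (hκ0 : 0 < κ)
    (hκ : κ < klBernoulli (μ a) (bestMean μ)) :
    ∃ C, ∀ T : ℕ, 1 ≤ T →
      expectedDraws (thompsonSampling K) μ a T ≤ Real.log T / κ + C := by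
  obtain ⟨o, ho⟩ := exists_eq_bestMean μ
  have hlt : (μ a : ℝ) < μ o := ho ▸ lt_of_le_of_ne (le_bestMean μ a) ha
  have ha0 : 0 ≤ (μ a : ℝ) := (μ a).2.1
  rw [← ho] at hκ
  obtain ⟨x, y, hax, hxy, hyo, hκxy⟩ := exists_levels hlt (ha0.trans_lt hlt) (hμ o) hκ
  have hx0 : 0 < x := ha0.trans_lt hax
  have hy0 : 0 < y := hx0.trans hxy
  have hy1 : y < 1 := hyo.trans (hμ o)
  set d := klBernoulli x y - κ with hd
  have hd0 : 0 < d := sub_pos.2 hκxy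
  set odds : ℕ → ℕ → ℝ := fun n s => (1 - posteriorTail y n s) / posteriorTail y n s with hodds
  have hodds0 : ∀ n s, s ≤ n → 0 ≤ odds n s := fun n s hs =>
    div_nonneg (sub_nonneg.2 (posteriorTail_le_one y hs)) (posteriorTail_pos hy0 hy1 hs).le
  have hsum1 := summable_binomialExpect_odds hy0 hyo (hμ o)
  have hsum2 := summable_binomialExpect_lt ha0 hax (hxy.trans hy1)
  refine ⟨1 + (∑' k : ℕ, binomialExpect (μ a) k fun i => if x * k < i then 1 else 0) +
    (1 / d + 1) + ∑' k, binomialExpect (μ o) k (odds k), fun T hT => ?_⟩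
  have hT0 : (0 : ℝ) < T := by exact_mod_cast hT
  set L := Real.log T / κ with hL
  have hL0 : 0 ≤ L := div_nonneg (Real.log_natCast_nonneg T) hκ0.le
  -- The rounds charged to `g` have few draws of `a`, or an unusually high success rate of `a`.
  set g : ℕ → ℕ → ℝ := fun n s =>
    (if (n : ℝ) < L then 1 else 0) + if x * n < s then 1 else 0 with hg
  have hg0 : ∀ n s, s ≤ n → 0 ≤ g n s := fun n s _ => by positivity
  have hstep (t : ℕ) (h : History K t) : (thompsonSampling K t h a).toReal ≤
      g (draws h a) (successes h a) * (thompsonSampling K t h a).toReal + (1 / d + 1) / T +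
        odds (draws h o) (successes h o) * (thompsonSampling K t h o).toReal := by
    have hπa : 0 ≤ (thompsonSampling K t h a).toReal := ENNReal.toReal_nonneg
    have hπo : 0 ≤ odds (draws h o) (successes h o) * (thompsonSampling K t h o).toReal :=
      mul_nonneg (hodds0 _ _ (successes_le_draws h o)) ENNReal.toReal_nonneg
    have hC : 0 ≤ (1 / d + 1) / (T : ℝ) := by positivity
    by_cases hbad : (draws h a : ℝ) < L ∨ x * draws h a < successes h a
    · have h1 : 1 ≤ g (draws h a) (successes h a) := by
        rw [hg]
        rcases hbad with hbad | hbad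
        · simp only [hbad, ↓reduceIte]
          exact le_add_of_nonneg_right (by positivity)
        · simp only [hbad, ↓reduceIte]
          exact le_add_of_nonneg_left (by positivity)
      have := le_mul_of_one_le_left hπa h1
      linarith
    · rw [not_or, not_lt, not_lt] at hbad
      have h1 := thompsonSampling_le h a o hy0 hy1
      have h2 := posteriorTail_le_exp hx0 hxy.le hy1 (successes_le_draws h a) hbad.2
      have h3 := succ_mul_exp_neg_le hd0 (draws h a)
      have h4 : Real.exp (-(draws h a * κ)) ≤ 1 / T := by
        rw [one_div, ← Real.exp_log (inv_pos.2 hT0), Real.log_inv]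
        have := (div_le_iff₀ hκ0).1 hbad.1
        gcongr
      have h5 : ((draws h a : ℝ) + 1) * Real.exp (-(draws h a * klBernoulli x y)) ≤
          (1 / d + 1) * (1 / T) := by
        have e : Real.exp (-(draws h a * klBernoulli x y)) =
            Real.exp (-(draws h a * d)) * Real.exp (-(draws h a * κ)) := by
          rw [← Real.exp_add, hd]
          congr 1
          ring
        rw [e, ← mul_assoc]
        gcongr
      rw [mul_one_div] at h5
      have h6 : 0 ≤ g (draws h a) (successes h a) * (thompsonSampling K t h a).toReal :=
        mul_nonneg (hg0 _ _ (successes_le_draws h a)) hπa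
      linarith
  have hround (t : ℕ) :
      expect (historyLaw (thompsonSampling K) μ t) (fun h => (thompsonSampling K t h a).toReal) ≤
        drawCost (thompsonSampling K) μ a g t + (1 / d + 1) / T +
          drawCost (thompsonSampling K) μ o odds t := by
    refine (expect_mono _ (hstep t)).trans (le_of_eq ?_)
    rw [expect_add, expect_add, expect_const]
    rfl
  have hA := expect_sum_draw_le_binomialExpect (thompsonSampling K) μ a hg0 T
  have hO := expect_sum_draw_le_binomialExpect (thompsonSampling K) μ o hodds0 T
  have hO' : ∑ k ∈ range T, binomialExpect (μ o) k (odds k) ≤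
      ∑' k, binomialExpect (μ o) k (odds k) :=
    hsum1.sum_le_tsum _ fun k _ =>
      binomialExpect_nonneg (μ o).2.1 (μ o).2.2 fun i hi => hodds0 k i hi
  have hA' : ∑ k ∈ range T, binomialExpect (μ a) k (g k) ≤
      L + 1 + ∑' k : ℕ, binomialExpect (μ a) k fun i => if x * k < i then 1 else 0 := by
    simp only [hg, binomialExpect_add, binomialExpect_const, sum_add_distrib]
    refine add_le_add (sum_ite_lt_le hL0 T) (hsum2.sum_le_tsum _ fun k _ => ?_)
    exact binomialExpect_nonneg ha0 (hμ a).le fun i _ => by positivity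
  have hconst : ∑ _t ∈ range T, (1 / d + 1) / (T : ℝ) = 1 / d + 1 := by
    rw [sum_const, card_range, nsmul_eq_mul]
    field_simp
  rw [expectedDraws_eq_sum]
  refine (sum_le_sum fun t _ => hround t).trans ?_
  rw [sum_add_distrib, sum_add_distrib, hconst]
  linarith

/-! ### Change of measure -/

section ChangeOfMeasure

variable {K : ℕ} (π : Policy K) {μ μ' : Fin K → unitInterval} {a : Fin K}

theorem expect_successes (π : Policy K) (μ : Fin K → unitInterval) (a : Fin K) (T : ℕ) :
    expect (historyLaw π μ T) (fun h => (successes h a : ℝ)) = μ a * expectedDraws π μ a T := by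
  induction T with
  | zero => simp [expectedDraws_zero, expect, successes]
  | succ t ih =>
    rw [expect_historyLaw_succ, expectedDraws_succ, mul_add, ← ih, ← expect_const_mul,
      ← expect_add]
    congr 1
    funext h
    have (b : Fin K) : (π t h b).toReal * (μ b * (successes (extend h b true) a : ℝ) +
        (1 - μ b) * (successes (extend h b false) a : ℝ)) =
        (π t h b).toReal * successes h a + if b = a then μ a * (π t h a).toReal else 0 := by
      simp only [successes_extend]
      by_cases hb : b = a
      · subst hb
        simp
        ring
      · simp only [hb, false_and, ↓reduceIte, add_zero]
        ring
    simp [this, sum_add_distrib, ← sum_mul, sum_toReal_eq_one]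

/-- The log-likelihood ratio between two bandits that differ in arm `a` only, whose means there are
`m` and `q`. For `m = 0` the junk value `log 0 = 0` is harmless, since arm `a` then has no
successes. -/
noncomputable def logLikelihoodRatio (m q : ℝ) (a : Fin K) {t : ℕ} (h : History K t) : ℝ :=
  successes h a * Real.log (m / q) + (draws h a - successes h a) * Real.log ((1 - m) / (1 - q))

theorem expect_logLikelihoodRatio (π : Policy K) (μ : Fin K → unitInterval) (a : Fin K) (q : ℝ)
    (T : ℕ) :
    expect (historyLaw π μ T) (logLikelihoodRatio (μ a) q a) =
      expectedDraws π μ a T * klBernoulli (μ a) q := by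
  have (h : History K T) : logLikelihoodRatio (μ a) q a h =
      Real.log (μ a / q) * successes h a +
        Real.log ((1 - μ a) / (1 - q)) * (draws h a - successes h a) := by
    rw [logLikelihoodRatio]
    ring
  simp only [funext this, expect_add, expect_const_mul, expect_sub, expect_successes]
  rw [← expectedDraws, klBernoulli]
  ring

/-- Weighting the law of the history in the bandit `μ` by the likelihood ratio gives the law in the
bandit `μ'`, restricted to the histories that are possible in `μ`: when `μ a = 0`, some mass of `μ'`
is lost, so only an inequality holds. -/
theorem expect_exp_neg_logLikelihoodRatio_mul_le (hne : ∀ b, b ≠ a → μ' b = μ b)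
    (hm : (μ a : ℝ) < 1) (hq0 : 0 < (μ' a : ℝ)) (hq1 : (μ' a : ℝ) < 1) {t : ℕ}
    {f : History K t → ℝ} (hf : ∀ h, 0 ≤ f h) :
    expect (historyLaw π μ t)
        (fun h => Real.exp (-logLikelihoodRatio (μ a) (μ' a) a h) * f h) ≤
      expect (historyLaw π μ' t) f := by
  induction t with
  | zero => simp [historyLaw, expect_pure, logLikelihoodRatio, draws, successes]
  | succ t ih =>
    rw [expect_historyLaw_succ, expect_historyLaw_succ]
    have hμ0 (b : Fin K) : 0 ≤ (μ' b : ℝ) := (μ' b).2.1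
    have hμ1 (b : Fin K) : 0 ≤ 1 - (μ' b : ℝ) := sub_nonneg.2 (μ' b).2.2
    refine le_trans (expect_mono _ fun h => ?_) (ih (f := _) fun h => sum_nonneg fun b _ =>
      mul_nonneg ENNReal.toReal_nonneg (add_nonneg (mul_nonneg (hμ0 b) (hf _))
        (mul_nonneg (hμ1 b) (hf _))))
    rw [mul_sum]
    refine sum_le_sum fun b _ => ?_
    set E := Real.exp (-logLikelihoodRatio (μ a) (μ' a) a h) with hE
    have hE0 : 0 ≤ E := Real.exp_nonneg _
    rw [mul_left_comm E]
    refine mul_le_mul_of_nonneg_left ?_ ENNReal.toReal_nonneg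
    rw [mul_add, ← mul_assoc, ← mul_assoc, ← mul_assoc, ← mul_assoc]
    have hm1 : 0 < 1 - (μ a : ℝ) := sub_pos.2 hm
    have hq1' : 0 < 1 - (μ' a : ℝ) := sub_pos.2 hq1
    by_cases hb : b = a
    · subst hb
      have e1 : Real.exp (-logLikelihoodRatio (μ b) (μ' b) b (extend h b true)) =
          E * Real.exp (-Real.log (μ b / μ' b)) := by
        rw [hE, ← Real.exp_add]
        simp only [logLikelihoodRatio, draws_extend, successes_extend]
        simp
        ring
      have e0 : Real.exp (-logLikelihoodRatio (μ b) (μ' b) b (extend h b false)) =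
          E * Real.exp (-Real.log ((1 - μ b) / (1 - μ' b))) := by
        rw [hE, ← Real.exp_add]
        simp only [logLikelihoodRatio, draws_extend, successes_extend]
        simp
        ring
      have k1 : μ b * Real.exp (-Real.log (μ b / μ' b)) ≤ μ' b := by
        rcases (μ b).2.1.eq_or_lt with h0 | h0
        · rw [← h0, zero_mul]
          exact hq0.le
        · rw [← Real.log_inv, Real.exp_log (by positivity)]
          apply le_of_eq
          field_simp
      have k0 : (1 - μ b) * Real.exp (-Real.log ((1 - μ b) / (1 - μ' b))) ≤ 1 - (μ' b : ℝ) := by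
        rw [← Real.log_inv, Real.exp_log (by positivity)]
        apply le_of_eq
        field_simp
      rw [e1, e0, mul_left_comm, mul_left_comm (1 - (μ b : ℝ))]
      have f1 := hf (extend h b true)
      have f0 := hf (extend h b false)
      gcongr
    · have e (r : Bool) : logLikelihoodRatio (μ a) (μ' a) a (extend h b r) =
          logLikelihoodRatio (μ a) (μ' a) a h := by
        simp [logLikelihoodRatio, draws_extend, successes_extend, hb]
      rw [e, e, ← hE, hne b hb, mul_comm E, mul_comm E]

theorem exp_expect_le {α : Type} [Fintype α] (p : PMF α) (f : α → ℝ) :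
    Real.exp (expect p f) ≤ expect p fun x => Real.exp (f x) := by
  simpa [expect] using convexOn_exp.map_sum_le (t := univ) (w := fun x => (p x).toReal) (p := f)
    (fun _ _ => ENNReal.toReal_nonneg) (sum_toReal_eq_one p) (fun _ _ => Set.mem_univ _)

/-- The Donsker-Varadhan inequality for the laws of the histories of two bandits that differ in arm
`a` only: their divergence is `E[N a] * K(μ a, μ' a)`. -/
theorem expect_sub_le_log_expect_exp (hne : ∀ b, b ≠ a → μ' b = μ b)
    (hm : (μ a : ℝ) < 1) (hq0 : 0 < (μ' a : ℝ)) (hq1 : (μ' a : ℝ) < 1) {T : ℕ}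
    (f : History K T → ℝ) :
    expect (historyLaw π μ T) f - expectedDraws π μ a T * klBernoulli (μ a) (μ' a) ≤
      Real.log (expect (historyLaw π μ' T) fun h => Real.exp (f h)) := by
  rw [← expect_logLikelihoodRatio, ← expect_sub]
  have h1 := (exp_expect_le (historyLaw π μ T)
    fun h => f h - logLikelihoodRatio (μ a) (μ' a) a h)
  have h2 := expect_exp_neg_logLikelihoodRatio_mul_le π hne hm hq0 hq1
    (f := fun h : History K T => Real.exp (f h)) fun _ => Real.exp_nonneg _
  rw [Real.le_log_iff_exp_le ((Real.exp_pos _).trans_le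
    (exp_expect_le (historyLaw π μ' T) f))]
  refine h1.trans (le_trans (le_of_eq ?_) h2)
  congr 1
  funext h
  rw [← Real.exp_add]
  congr 1
  ring

/-- If arm `a` is drawn in nearly all rounds of the bandit `μ'`, then it is drawn often in the bandit
`μ`, where only its mean is different. -/
theorem log_mul_one_sub_le (hne : ∀ b, b ≠ a → μ' b = μ b)
    (hm : (μ a : ℝ) < 1) (hq0 : 0 < (μ' a : ℝ)) (hq1 : (μ' a : ℝ) < 1) {T : ℕ} (hT : 1 ≤ T) :
    Real.log T * (1 - expectedDraws π μ a T / T) ≤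
      expectedDraws π μ a T * klBernoulli (μ a) (μ' a) +
        Real.log (1 + (T - expectedDraws π μ' a T)) := by
  have hT0 : (0 : ℝ) < T := by exact_mod_cast hT
  have h := expect_sub_le_log_expect_exp π hne hm hq0 hq1
    (fun h : History K T => Real.log T * (1 - 1 / T * (draws h a : ℝ)))
  rw [expect_const_mul, expect_sub, expect_const, expect_const_mul] at h
  change _ * (1 - 1 / T * expectedDraws π μ a T) - _ ≤ _ at h
  rw [one_div_mul_eq_div] at h
  have h2 : expect (historyLaw π μ' T)
      (fun h => Real.exp (Real.log T * (1 - 1 / T * (draws h a : ℝ)))) ≤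
      1 + (T - expectedDraws π μ' a T) := by
    have e : 1 + (T - expectedDraws π μ' a T) =
        expect (historyLaw π μ' T) fun h => 1 + (T - (draws h a : ℝ)) := by
      rw [expect_add, expect_sub, expect_const, expect_const, expectedDraws]
    rw [e]
    refine expect_mono _ fun h => ?_
    have hd : (draws h a : ℝ) ≤ T := by
      have := single_le_sum (f := draws h) (fun _ _ => Nat.zero_le _) (mem_univ a)
      rw [sum_draws] at this
      exact_mod_cast this
    -- Convexity of `exp` between `0` and `log T`.
    have hv0 : 0 ≤ 1 - 1 / T * (draws h a : ℝ) := by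
      rw [sub_nonneg, one_div_mul_eq_div]
      exact (div_le_one hT0).2 hd
    have hw0 : 0 ≤ 1 / T * (draws h a : ℝ) := by positivity
    have hc := convexOn_exp.2 (Set.mem_univ (Real.log T)) (Set.mem_univ 0) hv0 hw0 (by ring)
    simp only [smul_eq_mul, mul_zero, add_zero, Real.exp_zero, mul_one, Real.exp_log hT0] at hc
    rw [mul_comm]
    refine hc.trans ?_
    have h1 : 1 / T * (draws h a : ℝ) ≤ 1 := by linarith
    have h3 : (1 - 1 / T * (draws h a : ℝ)) * T = T - draws h a := by field_simp
    linarith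
  have h3 := Real.log_le_log ((Real.exp_pos _).trans_le (exp_expect_le _ _)) h2
  linarith

end ChangeOfMeasure

/-! ### The Lai-Robbins lower bound -/

section LowerBound

variable {K : ℕ} [NeZero K] {μ : Fin K → unitInterval} {a : Fin K}

theorem exists_expectedDraws_le_mul (hμ : ∀ a, (μ a : ℝ) < 1)
    (ha : (μ a : ℝ) ≠ bestMean μ) :
    ∃ C, 0 ≤ C ∧ ∀ T : ℕ, 1 ≤ T →
      expectedDraws (thompsonSampling K) μ a T ≤ C * (Real.log T + 1) := by
  have hk := klBernoulli_bestMean_pos hμ ha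
  obtain ⟨C, hC⟩ := exists_expectedDraws_le hμ ha (half_pos hk) (half_lt_self hk)
  refine ⟨max C (1 / (klBernoulli (μ a) (bestMean μ) / 2)),
    le_max_of_le_right (by positivity), fun T hT => (hC T hT).trans ?_⟩
  have h1 := le_max_left C (1 / (klBernoulli (μ a) (bestMean μ) / 2))
  have h2 := mul_le_mul_of_nonneg_right
    (le_max_right C (1 / (klBernoulli (μ a) (bestMean μ) / 2))) (Real.log_natCast_nonneg T)
  rw [one_div_mul_eq_div] at h2
  linarith

theorem tendsto_log_natCast : Tendsto (fun T : ℕ => Real.log T) atTop atTop :=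
  Real.tendsto_log_atTop.comp tendsto_natCast_atTop_atTop

theorem tendsto_log_div_natCast : Tendsto (fun T : ℕ => Real.log T / T) atTop (𝓝 0) :=
  Real.isLittleO_log_id_atTop.tendsto_div_nhds_zero.comp tendsto_natCast_atTop_atTop

theorem tendsto_expectedDraws_div (hμ : ∀ a, (μ a : ℝ) < 1) (ha : (μ a : ℝ) ≠ bestMean μ) :
    Tendsto (fun T : ℕ => expectedDraws (thompsonSampling K) μ a T / T) atTop (𝓝 0) := by
  obtain ⟨C, _, hC⟩ := exists_expectedDraws_le_mul hμ ha
  have h1 : Tendsto (fun T : ℕ => C * (Real.log T / T + 1 / T)) atTop (𝓝 0) := by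
    simpa using (tendsto_log_div_natCast.add tendsto_one_div_atTop_nhds_zero_nat).const_mul C
  refine squeeze_zero' (Eventually.of_forall fun T => ?_) ?_ h1
  · exact div_nonneg (expect_nonneg _ fun _ => Nat.cast_nonneg _) (Nat.cast_nonneg _)
  · filter_upwards [eventually_ge_atTop 1] with T hT
    rw [← add_div, ← mul_div_assoc]
    exact div_le_div_of_nonneg_right (hC T hT) (Nat.cast_nonneg _)

theorem tendsto_log_const_mul_log_div {C : ℝ} (hC : 0 < C) :
    Tendsto (fun T : ℕ => Real.log (C * Real.log T) / Real.log T) atTop (𝓝 0) := by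
  have h1 : Tendsto (fun T : ℕ => Real.log C / Real.log T) atTop (𝓝 0) :=
    tendsto_const_nhds.div_atTop tendsto_log_natCast
  have h2 : Tendsto (fun T : ℕ => Real.log (Real.log T) / Real.log T) atTop (𝓝 0) :=
    Real.isLittleO_log_id_atTop.tendsto_div_nhds_zero.comp tendsto_log_natCast
  have h3 := h1.add h2
  rw [add_zero] at h3
  refine h3.congr' ?_
  filter_upwards [tendsto_log_natCast.eventually_gt_atTop 0] with T hT
  rw [Real.log_mul hC.ne' hT.ne', add_div]

/-- An arm whose mean exceeds all others is drawn in all but `O(ln T)` rounds. -/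
theorem exists_sub_expectedDraws_le (hμ : ∀ a, (μ a : ℝ) < 1)
    (ha : ∀ b, b ≠ a → (μ b : ℝ) < μ a) :
    ∃ C, 0 ≤ C ∧ ∀ T : ℕ, 1 ≤ T →
      T - expectedDraws (thompsonSampling K) μ a T ≤ C * (Real.log T + 1) := by
  have hbest (b : Fin K) (hb : b ≠ a) : (μ b : ℝ) ≠ bestMean μ :=
    ((ha b hb).trans_le (le_bestMean μ a)).ne
  have hex (b : Fin K) : ∃ C, 0 ≤ C ∧ (b ≠ a → ∀ T : ℕ, 1 ≤ T →
      expectedDraws (thompsonSampling K) μ b T ≤ C * (Real.log T + 1)) := by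
    by_cases hb : b = a
    · exact ⟨0, le_rfl, fun h => absurd hb h⟩
    · obtain ⟨C, hC0, hC⟩ := exists_expectedDraws_le_mul hμ (hbest b hb)
      exact ⟨C, hC0, fun _ => hC⟩
  choose C hC0 hC using hex
  refine ⟨∑ b ∈ univ.erase a, C b, sum_nonneg fun b _ => hC0 b, fun T hT => ?_⟩
  have hsum := add_sum_erase univ (fun b => expectedDraws (thompsonSampling K) μ b T) (mem_univ a)
  rw [sum_expectedDraws] at hsum
  rw [← eq_sub_iff_add_eq'.2 hsum, sum_mul]
  exact sum_le_sum fun b hb => hC b (ne_of_mem_erase hb) T hT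

/-- Arm `a` has to be drawn often enough to tell the bandit `μ` from one where its mean is `q` and it
is the best arm. -/
theorem eventually_lt_expectedDraws_div_log (hμ : ∀ a, (μ a : ℝ) < 1)
    (ha : (μ a : ℝ) ≠ bestMean μ) {q : ℝ} (hq : bestMean μ < q) (hq1 : q < 1) {c : ℝ}
    (hc : c * klBernoulli (μ a) q < 1) :
    ∀ᶠ T : ℕ in atTop, c < expectedDraws (thompsonSampling K) μ a T / Real.log T := by
  classical
  have haq : (μ a : ℝ) < q := (le_bestMean μ a).trans_lt hq
  have hq0 : 0 < q := (μ a).2.1.trans_lt haq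
  have hk := klBernoulli_pos (μ a).2.1 (hμ a) hq0 hq1 haq.ne
  set μ' : Fin K → unitInterval := Function.update μ a ⟨q, hq0.le, hq1.le⟩ with hμ'
  have hself : (μ' a : ℝ) = q := by simp [hμ']
  have hne : ∀ b, b ≠ a → μ' b = μ b := fun b hb => by simp [hμ', hb]
  have hμ'1 : ∀ b, (μ' b : ℝ) < 1 := fun b => by
    by_cases hb : b = a
    · rw [hb, hself]
      exact hq1
    · rw [hne b hb]
      exact hμ b
  obtain ⟨C, hC0, hC⟩ := exists_sub_expectedDraws_le (a := a) hμ'1 fun b hb => by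
    rw [hself, hne b hb]
    exact (le_bestMean μ b).trans_lt hq
  have hlim : Tendsto (fun T : ℕ => 1 - expectedDraws (thompsonSampling K) μ a T / T -
      Real.log ((1 + 2 * C) * Real.log T) / Real.log T) atTop (𝓝 1) := by
    simpa using ((tendsto_expectedDraws_div hμ ha).const_sub 1).sub
      (tendsto_log_const_mul_log_div (C := 1 + 2 * C) (by positivity))
  filter_upwards [hlim.eventually_const_lt hc, tendsto_log_natCast.eventually_ge_atTop 1,
    eventually_ge_atTop 1] with T h1 hlog hT
  have hlog0 : 0 < Real.log T := by linarith
  have h2 := log_mul_one_sub_le (thompsonSampling K) hne (hμ a) (by rwa [hself])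
    (by rwa [hself]) hT
  rw [hself] at h2
  have hsub : 0 ≤ T - expectedDraws (thompsonSampling K) μ' a T := by
    rw [sub_nonneg, ← sum_expectedDraws (thompsonSampling K) μ' T]
    exact single_le_sum (f := fun b => expectedDraws (thompsonSampling K) μ' b T)
      (fun b _ => expect_nonneg _ fun _ => Nat.cast_nonneg _) (mem_univ a)
  have h3 : Real.log (1 + (T - expectedDraws (thompsonSampling K) μ' a T)) ≤
      Real.log ((1 + 2 * C) * Real.log T) := by
    refine Real.log_le_log (by linarith) ?_
    have := hC T hT
    nlinarith
  refine lt_of_mul_lt_mul_right (h1.trans_le ?_) hk.le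
  rw [sub_le_iff_le_add, div_mul_eq_mul_div, ← add_div, le_div_iff₀ hlog0]
  linarith

theorem tendsto_expectedDraws_div_log (hμ : ∀ a, (μ a : ℝ) < 1)
    (ha : (μ a : ℝ) ≠ bestMean μ) :
    Tendsto (fun T : ℕ => expectedDraws (thompsonSampling K) μ a T / Real.log T) atTop
      (𝓝 (1 / klBernoulli (μ a) (bestMean μ))) := by
  have hk := klBernoulli_bestMean_pos hμ ha
  have hb1 := bestMean_lt_one hμ
  have hb0 : 0 < bestMean μ := (μ a).2.1.trans_lt (lt_of_le_of_ne (le_bestMean μ a) ha)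
  refine tendsto_order.2 ⟨fun c hc => ?_, fun c hc => ?_⟩
  · rw [lt_div_iff₀ hk] at hc
    have hcont : Tendsto (fun q => c * klBernoulli (μ a) q) (𝓝[>] bestMean μ)
        (𝓝 (c * klBernoulli (μ a) (bestMean μ))) := by
      have h1 : Tendsto (fun q : ℝ => ((μ a : ℝ), q)) (𝓝[>] bestMean μ)
          (𝓝 ((μ a : ℝ), bestMean μ)) :=
        tendsto_const_nhds.prodMk_nhds nhdsWithin_le_nhds
      exact ((continuousAt_klBernoulli (μ a) hb0 hb1).tendsto.comp h1).const_mul c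
    have hI : ∀ᶠ q in 𝓝[>] bestMean μ, q ∈ Set.Ioo (bestMean μ) 1 := Ioo_mem_nhdsGT hb1
    obtain ⟨q, hq, hq'⟩ := ((hcont.eventually_lt_const hc).and hI).exists
    exact eventually_lt_expectedDraws_div_log hμ ha hq'.1 hq'.2 hq
  · have hc0 : 0 < c := (one_div_pos.2 hk).trans hc
    obtain ⟨κ, hκ1, hκ2⟩ := exists_between ((one_div_lt hk hc0).1 hc)
    have hκ0 : 0 < κ := (one_div_pos.2 hc0).trans hκ1
    obtain ⟨C, hC⟩ := exists_expectedDraws_le hμ ha hκ0 hκ2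
    have hlim : Tendsto (fun T : ℕ => 1 / κ + C / Real.log T) atTop (𝓝 (1 / κ)) := by
      simpa using (tendsto_const_nhds.div_atTop tendsto_log_natCast).const_add (1 / κ)
    filter_upwards [hlim.eventually_lt_const ((one_div_lt hc0 hκ0).1 hκ1),
      tendsto_log_natCast.eventually_gt_atTop 0, eventually_ge_atTop 1] with T h1 hlog hT
    refine lt_of_le_of_lt ?_ h1
    rw [div_le_iff₀ hlog]
    refine (hC T hT).trans (le_of_eq ?_)
    field_simp

end LowerBound

/-! ### The regret -/

theorem neg_one_le_log_log {T : ℕ} (hT : 2 ≤ T) : -1 ≤ Real.log (Real.log T) := by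
  have h1 : Real.log 2 ≤ Real.log T := Real.log_le_log (by norm_num) (by exact_mod_cast hT)
  have h2 := Real.log_two_gt_d9
  rw [Real.le_log_iff_exp_le (by linarith)]
  have h3 := Real.exp_neg_one_lt_d9
  linarith

theorem exists_regret_le {K : ℕ} [NeZero K] {μ : Fin K → unitInterval}
    (hμ : ∀ a, (μ a : ℝ) < 1) {ε : ℝ} (hε : 0 < ε) : ∃ C : ℝ, ∀ T : ℕ, 2 ≤ T →
      regret (thompsonSampling K) μ T ≤
        (1 + ε) * ∑ a ∈ Finset.univ.filter (fun a => (μ a : ℝ) ≠ bestMean μ),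
          (bestMean μ - μ a) * (Real.log T + Real.log (Real.log T)) /
            klBernoulli (μ a) (bestMean μ) + C := by
  have hex (a : Fin K) : ∃ C, (μ a : ℝ) ≠ bestMean μ → ∀ T : ℕ, 1 ≤ T →
      expectedDraws (thompsonSampling K) μ a T ≤
        Real.log T / (klBernoulli (μ a) (bestMean μ) / (1 + ε)) + C := by
    by_cases ha : (μ a : ℝ) = bestMean μ
    · exact ⟨0, fun h => absurd ha h⟩
    · have hk := klBernoulli_bestMean_pos hμ ha
      obtain ⟨C, hC⟩ := exists_expectedDraws_le hμ ha
        (κ := klBernoulli (μ a) (bestMean μ) / (1 + ε)) (by positivity) (div_lt_self hk (by linarith))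
      exact ⟨C, fun _ => hC⟩
  choose C hC using hex
  refine ⟨∑ a ∈ univ.filter (fun a => (μ a : ℝ) ≠ bestMean μ), (bestMean μ - μ a) *
    (C a + (1 + ε) / klBernoulli (μ a) (bestMean μ)), fun T hT => ?_⟩
  have hzero : ∑ a, (bestMean μ - μ a) * expectedDraws (thompsonSampling K) μ a T =
      ∑ a ∈ univ.filter (fun a => (μ a : ℝ) ≠ bestMean μ),
        (bestMean μ - μ a) * expectedDraws (thompsonSampling K) μ a T := by
    refine (sum_filter_of_ne (p := fun a => (μ a : ℝ) ≠ bestMean μ) fun a _ h heq => h ?_).symm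
    rw [heq, sub_self, zero_mul]
  rw [regret_eq_sum, hzero, mul_sum, ← sum_add_distrib]
  refine sum_le_sum fun a ha => ?_
  have ha := (mem_filter.1 ha).2
  have hk := klBernoulli_bestMean_pos hμ ha
  have hgap : 0 ≤ bestMean μ - μ a := sub_nonneg.2 (le_bestMean μ a)
  have hlog := neg_one_le_log_log hT
  calc (bestMean μ - μ a) * expectedDraws (thompsonSampling K) μ a T
      ≤ (bestMean μ - μ a) *
        ((Real.log T + Real.log (Real.log T) + 1) /
          (klBernoulli (μ a) (bestMean μ) / (1 + ε)) + C a) := by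
        refine mul_le_mul_of_nonneg_left ((hC a ha T (by lia)).trans ?_) hgap
        gcongr
        linarith
    _ = _ := by
        field_simp
        ring

end BernoulliBandit

open BernoulliBandit in
theorem theorem1 (K : ℕ) [NeZero K] (μ : Fin K → unitInterval) (hμ : ∀ a, (μ a : ℝ) < 1) :
    (∀ ε : ℝ, 0 < ε → ∃ C : ℝ, ∀ T : ℕ, 2 ≤ T →
      regret (thompsonSampling K) μ T ≤
        (1 + ε) * ∑ a ∈ Finset.univ.filter (fun a => (μ a : ℝ) ≠ bestMean μ),
          (bestMean μ - μ a) * (Real.log T + Real.log (Real.log T)) /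
            klBernoulli (μ a) (bestMean μ) + C) ∧
    (∀ a : Fin K, (μ a : ℝ) ≠ bestMean μ →
      Tendsto (fun T : ℕ => expectedDraws (thompsonSampling K) μ a T / Real.log T) atTop
        (𝓝 (1 / klBernoulli (μ a) (bestMean μ)))) := by
  exact ⟨fun _ hε => exists_regret_le hμ hε, fun _ ha => tendsto_expectedDraws_div_log hμ ha⟩
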